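/- Let $S^2\subset\mathbb{R}^3$ be the unit sphere with the metric $g$ induced from the Euclidean one. For $p\in S^2$ let $J_p(u)=u\times p$ on $T_pS^2$ and let $\omega=g(J\cdot,\cdot)$ be the resulting area form. Let $\eta$ be the associated Poisson structure on $S^2$: $\eta(\xi,\zeta)=\zeta(X_\xi)$, where $\omega(X_\xi,\cdot)=\xi$. Write $q:TS^2\to S^2$ for the projection and, for a $1$-form $\alpha$ on $S^2$, $\tilde\alpha:TS^2\to\mathbb{R}$, $\tilde\alpha(v)=\alpha(v)$. The tangent bundle $TS^2$, as the dual of the cotangent Lie algebroid $T^*S^2$, carries the Poisson structure (a bivector field with bracket $\{\cdot,\cdot\}_{TS^2}$) that is the unique bivector field satisfying, for all smooth closed $1$-forms $\alpha,\beta$ and all smooth functions $f,h$ on $S^2$, $$\{\tilde\alpha,\tilde\beta\}_{TS^2}(v)=[\alpha,\beta](v),\qquad \{q^*f,q^*h\}_{TS^2}=0,\qquad \{\tilde\alpha,q^*f\}_{TS^2}=q^*\big(\eta(\alpha,df)\big),$$ where $[\alpha,\beta]=d(\eta(\alpha,\beta))$ is the Lie algebroid bracket of the closed forms $\alpha,\beta$.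 Let $\mathrm{Exp}_p(u)=\cos(|u|)\,p+\frac{\sin|u|}{|u|}\,u$ (with $\mathrm{Exp}_p(0)=p$) be the Riemannian exponential map of $S^2$. Proposition. There is exactly one bivector field on $TS^2$ with these properties, and for it the map $$\pi(u,p)=\mathrm{Exp}_p\Big(\tfrac{1}{|u|}\arcsin\big(\tfrac{|u|}{2}\big)\,u\Big),\qquad \pi(0,p)=p,$$ is a Poisson map to $(S^2,\eta)$ on the open neighbourhood $\{(u,p)\in TS^2: |u|<2\}$ of the zero section: $\pi$ is smooth there, and $\{f\circ\pi,h\circ\pi\}_{TS^2}=\{f,h\}_{S^2}\circ\pi$ there for all smooth functions $f,h$ on $S^2$. -/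

import Mathlib

open scoped Manifold ContDiff RealInnerProductSpace

noncomputable section

/-! ### Bivector fields and brackets on a manifold -/

section General

variable {E : Type*} [NormedAddCommGroup E] [NormedSpace ℝ E]
  {H : Type*} [TopologicalSpace H] (I : ModelWithCorners ℝ E H)
  (M : Type*) [TopologicalSpace M] [ChartedSpace H M]

/-- A field of bivectors on `M`: at every point, an alternating bilinear form on the cotangent
space. -/
@[ext]
structure BivectorField where
  toFun : ∀ x : M, (TangentSpace I x →L[ℝ] ℝ) →ₗ[ℝ] (TangentSpace I x →L[ℝ] ℝ) →ₗ[ℝ] ℝ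
  alt : ∀ (x : M) (ξ : TangentSpace I x →L[ℝ] ℝ), toFun x ξ ξ = 0

variable {I M}

/-- The bracket `{f, g} = ⟨Λ, df ∧ dg⟩` of two functions. -/
def BivectorField.bracket (Λ : BivectorField I M) (f g : M → ℝ) (x : M) : ℝ :=
  Λ.toFun x (mvfderiv I f x) (mvfderiv I g x)

/-- The function `Λ(α, β)` for two `1`-forms. -/
def BivectorField.pairing (Λ : BivectorField I M)
    (α β : ∀ x : M, TangentSpace I x →L[ℝ] ℝ) (x : M) : ℝ :=
  Λ.toFun x (α x) (β x)

/-- The function `v ↦ α(v)` on the tangent bundle defined by a `1`-form `α`. -/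
def tilde (α : ∀ x : M, TangentSpace I x →L[ℝ] ℝ) (v : TangentBundle I M) : ℝ :=
  α v.1 v.2

/-- The expression of a `1`-form in the preferred chart at `x₀`, that is, its pull-back by the
inverse of the chart. -/
def formInChart (α : ∀ x : M, TangentSpace I x →L[ℝ] ℝ) (x₀ : M) (y : E) : E →L[ℝ] ℝ :=
  (α ((extChartAt I x₀).symm y)).comp
    (mfderivWithin 𝓘(ℝ, E) I (extChartAt I x₀).symm (Set.range I) y)

/-- `α` is a smooth closed `1`-form: `α` is smooth and, in every preferred chart,
`dα(v, w) = (∂_v α)(w) - (∂_w α)(v)` vanishes. -/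
structure IsClosedOneForm [IsManifold I 1 M]
    (α : ∀ x : M, TangentSpace I x →L[ℝ] ℝ) : Prop where
  smooth : ContMDiff I.tangent 𝓘(ℝ, ℝ) ∞ (tilde α)
  closed : ∀ x₀ : M, ∀ y ∈ (extChartAt I x₀).target, ∀ v w : E,
    fderivWithin ℝ (formInChart α x₀) (Set.range I) y v w
      = fderivWithin ℝ (formInChart α x₀) (Set.range I) y w v

/-- The bracket `[α, β] = L_{Λ♯α} β - L_{Λ♯β} α - d(Λ(α, β))` of the Lie algebroid `T*M` of a
Poisson manifold, restricted to closed `1`-forms. For closed `α` and `β`, Cartan's formula gives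
`L_{Λ♯α} β = d(Λ(α, β))` and `L_{Λ♯β} α = -d(Λ(α, β))`, so `[α, β] = d(Λ(α, β))`. -/
def closedFormBracket (Λ : BivectorField I M)
    (α β : ∀ x : M, TangentSpace I x →L[ℝ] ℝ) (x : M) : TangentSpace I x →L[ℝ] ℝ :=
  mvfderiv I (Λ.pairing α β) x

/-- `Λ` is the (fibrewise linear) Poisson structure on the tangent bundle `TM`, viewed as the dual
of the cotangent Lie algebroid of the Poisson manifold `(M, η)`: with `p : TM → M` the projection,
for closed `1`-forms `α, β` and smooth functions `f, g` on `M`,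
`{α~, β~}(v) = [α, β](v)`, `{p^*f, p^*g} = 0` and `{α~, p^*f}(v) = η(α) · f`. -/
structure IsTangentPoisson [IsManifold I 1 M] (η : BivectorField I M)
    (Λ : BivectorField I.tangent (TangentBundle I M)) : Prop where
  tilde_tilde : ∀ α β : ∀ x : M, TangentSpace I x →L[ℝ] ℝ,
    IsClosedOneForm α → IsClosedOneForm β → ∀ v : TangentBundle I M,
      Λ.bracket (tilde α) (tilde β) v = closedFormBracket η α β v.1 v.2
  pull_pull : ∀ f g : M → ℝ, ContMDiff I 𝓘(ℝ, ℝ) ∞ f → ContMDiff I 𝓘(ℝ, ℝ) ∞ g →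
    ∀ v : TangentBundle I M,
      Λ.bracket (fun w : TangentBundle I M => f w.1) (fun w : TangentBundle I M => g w.1) v = 0
  tilde_pull : ∀ (α : ∀ x : M, TangentSpace I x →L[ℝ] ℝ) (f : M → ℝ),
    IsClosedOneForm α → ContMDiff I 𝓘(ℝ, ℝ) ∞ f → ∀ v : TangentBundle I M,
      Λ.bracket (tilde α) (fun w : TangentBundle I M => f w.1) v
        = η.toFun v.1 (α v.1) (mvfderiv I f v.1)

/-- `π`, restricted to the set `U`, is a Poisson map from `(M, Λ)` to `(N, η)`: it is smooth on `U`
and `{π^*f, π^*g} = π^*{f, g}` on `U` for all smooth functions `f, g` on `N`. -/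
structure IsPoissonMapOn {E' : Type*} [NormedAddCommGroup E'] [NormedSpace ℝ E']
    {H' : Type*} [TopologicalSpace H'] {J : ModelWithCorners ℝ E' H'}
    {N : Type*} [TopologicalSpace N] [ChartedSpace H' N]
    (Λ : BivectorField I M) (η : BivectorField J N) (π : M → N) (U : Set M) : Prop where
  smooth : ContMDiffOn I J ∞ π U
  bracket_comp : ∀ f g : N → ℝ, ContMDiff J 𝓘(ℝ, ℝ) ∞ f → ContMDiff J 𝓘(ℝ, ℝ) ∞ g →
    ∀ x ∈ U, Λ.bracket (f ∘ π) (g ∘ π) x = η.bracket f g (π x)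

end General

/-! ### The round `2`-sphere -/

/-- Euclidean `3`-space. -/
abbrev E3 : Type := EuclideanSpace ℝ (Fin 3)

/-- The unit sphere of Euclidean `3`-space. -/
abbrev S2 : Type := Metric.sphere (0 : E3) 1

/-- The tangent bundle of the sphere. -/
abbrev TS2 : Type := TangentBundle (𝓡 2) S2

/-- The differential at `p` of the inclusion of the sphere in Euclidean space: it identifies
`T_p S²` with the orthogonal complement of `p`. -/
def incl (p : S2) : TangentSpace (𝓡 2) p →L[ℝ] E3 :=
  mvfderiv (𝓡 2) (fun x : S2 => (x : E3)) p

/-- The norm of the round metric on `T_p S²`. -/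
def tnorm (p : S2) (u : TangentSpace (𝓡 2) p) : ℝ := ‖incl p u‖

/-- The cross product of Euclidean `3`-space. -/
def cross (a b : E3) : E3 := WithLp.toLp 2 (crossProduct a.ofLp b.ofLp)

lemma incl_injective (p : S2) : Function.Injective (incl p) := by
  have := Fact.mk (@finrank_euclideanSpace_fin ℝ _ 3)
  exact injective_mvfderiv_subtypeVal_sphere (n := 2) p

lemma incl_range (p : S2) : (incl p).range = (ℝ ∙ (p : E3))ᗮ := by
  have := Fact.mk (@finrank_euclideanSpace_fin ℝ _ 3)
  exact range_mvfderiv_subtypeVal (n := 2) p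

lemma inner_cross_self (a b : E3) : ⟪cross a b, a⟫ = 0 := by
  simp [cross, PiLp.inner_apply, Fin.sum_univ_three, cross_apply]
  ring

lemma inner_cross_right (a b : E3) : ⟪cross a b, b⟫ = 0 := by
  simp [cross, PiLp.inner_apply, Fin.sum_univ_three, cross_apply]
  ring

lemma inner_incl (p : S2) (u : TangentSpace (𝓡 2) p) : ⟪(p : E3), incl p u⟫ = 0 := by
  have h : incl p u ∈ (ℝ ∙ (p : E3))ᗮ := incl_range p ▸ LinearMap.mem_range_self _ u
  exact Submodule.mem_orthogonal_singleton_iff_inner_right.mp h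

/-- The area form `ω_p(u, v) = g(J_p u, v)` of the sphere, where `J_p u = u × p`. -/
def areaForm (p : S2) : LinearMap.BilinForm ℝ (TangentSpace (𝓡 2) p) :=
  LinearMap.mk₂ ℝ (fun u v => ⟪cross (incl p u) p, incl p v⟫)
    (fun u u' v => by simp [cross, inner_add_left])
    (fun c u v => by simp [cross, inner_smul_left])
    (fun u v v' => by simp [inner_add_right])
    (fun c u v => by simp [inner_smul_right])

lemma areaForm_apply (p : S2) (u v : TangentSpace (𝓡 2) p) :
    areaForm p u v = ⟪cross (incl p u) p, incl p v⟫ := rfl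

lemma areaForm_self (p : S2) (u : TangentSpace (𝓡 2) p) : areaForm p u u = 0 := by
  rw [areaForm_apply, inner_cross_self]

lemma inner_cross_cross (a b : E3) :
    ⟪cross a b, cross a b⟫ = ⟪a, a⟫ * ⟪b, b⟫ - ⟪a, b⟫ ^ 2 := by
  simp [cross, -inner_self_eq_norm_sq_to_K, PiLp.inner_apply, Fin.sum_univ_three, cross_apply]
  ring

lemma areaForm_isAlt (p : S2) : (areaForm p).IsAlt := areaForm_self p

lemma areaForm_nondegenerate (p : S2) : (areaForm p).Nondegenerate := by
  have key : ∀ u : TangentSpace (𝓡 2) p, (∀ v, areaForm p u v = 0) → u = 0 := by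
    intro u hu
    have hJ : cross (incl p u) p ∈ (incl p).range := by
      rw [incl_range]
      refine Submodule.mem_orthogonal_singleton_iff_inner_left.mpr (inner_cross_right _ _)
    obtain ⟨v, hv⟩ := hJ
    have h := hu v
    rw [areaForm_apply] at h
    change incl p v = _ at hv
    rw [hv, inner_cross_cross, real_inner_comm (p : E3) (incl p u), inner_incl, real_inner_self_eq_norm_sq (p : E3),
      norm_eq_of_mem_sphere p] at h
    have h0 : incl p u = 0 := by simpa using h
    exact incl_injective p (by rw [h0, map_zero])
  refine ⟨key, fun v hv => key v fun u => ?_⟩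
  rw [← (areaForm_isAlt p).neg_eq u v, hv u, neg_zero]

instance (p : S2) : FiniteDimensional ℝ (TangentSpace (𝓡 2) p) :=
  inferInstanceAs (FiniteDimensional ℝ (EuclideanSpace ℝ (Fin 2)))

/-- The Hamiltonian vector `X` of a covector `ξ`, determined by `ω(X, ·) = ξ`. -/
def hamVec (p : S2) : (TangentSpace (𝓡 2) p →L[ℝ] ℝ) →ₗ[ℝ] TangentSpace (𝓡 2) p :=
  (LinearMap.BilinForm.toDual (areaForm p) (areaForm_nondegenerate p)).symm.toLinearMap ∘ₗ
    ContinuousLinearMap.coeLM ℝ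

lemma areaForm_hamVec (p : S2) (ξ : TangentSpace (𝓡 2) p →L[ℝ] ℝ) (v : TangentSpace (𝓡 2) p) :
    areaForm p (hamVec p ξ) v = ξ v := by
  simp [hamVec]

/-- The Poisson structure of the sphere defined by the area form: `η(ξ, ζ) = ζ(X_ξ)` with
`ω(X_ξ, ·) = ξ`. -/
def sphereBivector : BivectorField (𝓡 2) S2 where
  toFun p := LinearMap.mk₂ ℝ (fun ξ ζ => ζ (hamVec p ξ))
    (fun _ _ _ => by simp) (fun _ _ _ => by simp) (fun _ _ _ => by simp) (fun _ _ _ => by simp)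
  alt p ξ := by
    rw [LinearMap.mk₂_apply, ← areaForm_hamVec p ξ, areaForm_self]

/-! ### The exponential map of the round sphere -/

/-- The exponential map of the round metric,
`Exp_p(u) = cos(|u|) p + (sin(|u|) / |u|) u`, with value `p` at `u = 0`. -/
def sphereExp (p : S2) (u : TangentSpace (𝓡 2) p) : S2 :=
  ⟨Real.cos (tnorm p u) • (p : E3) + (Real.sin (tnorm p u) / tnorm p u) • incl p u, by
    rw [mem_sphere_zero_iff_norm, ← sq_eq_sq₀ (norm_nonneg _) zero_le_one,
      norm_add_sq_real, norm_smul, norm_smul, inner_smul_left, inner_smul_right, inner_incl,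
      norm_eq_of_mem_sphere p]
    rw [show ‖incl p u‖ = tnorm p u from rfl]
    rcases eq_or_ne (tnorm p u) 0 with h | h
    · simp [h]
    · have := Real.sin_sq_add_cos_sq (tnorm p u)
      simp [div_pow, mul_pow]
      field_simp
      linarith⟩

/-- A geodesic of the round sphere, parametrised by `ℝ`: a smooth curve whose covariant
acceleration, that is, the tangential part of its acceleration in Euclidean space, vanishes. -/
structure IsSphereGeodesic (γ : ℝ → S2) : Prop where
  smooth : ContDiff ℝ ∞ (fun t => (γ t : E3))
  accel : ∀ t, ∃ c : ℝ, deriv (deriv fun s => (γ s : E3)) t = c • (γ t : E3)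

/-- The curve `t ↦ Exp_p(t u)` is a geodesic with initial point `p` and initial velocity `u`. -/
theorem sphereExp_curve (p : S2) (u : TangentSpace (𝓡 2) p) :
    IsSphereGeodesic (fun t => sphereExp p (t • u)) ∧ sphereExp p ((0 : ℝ) • u) = p ∧
      deriv (fun t : ℝ => (sphereExp p (t • u) : E3)) 0 = incl p u ∧
      ∀ t, deriv (deriv fun t : ℝ => (sphereExp p (t • u) : E3)) t =
        (-tnorm p u ^ 2) • (sphereExp p (t • u) : E3) := by
  set k := tnorm p u with hk
  have hcurve : ∀ t : ℝ, (sphereExp p (t • u) : E3) =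
      Real.cos (k * t) • (p : E3) + (Real.sin (k * t) / k) • incl p u := by
    intro t
    have ht : tnorm p (t • u) = |t| * k := by
      rw [tnorm, map_smul, norm_smul, Real.norm_eq_abs]; rfl
    simp only [sphereExp, ht, map_smul, smul_smul]
    congr 2
    · rcases abs_cases t with h | h <;> rw [h.1] <;> simp [mul_comm]
    · rcases eq_or_ne t 0 with h0 | h0
      · simp [h0]
      rcases eq_or_ne k 0 with h1 | h1
      · simp [h1]
      rcases abs_cases t with h | h <;> rw [h.1] <;> simp [mul_comm t k] <;> field_simp
  have hu0 : k = 0 → incl p u = 0 := fun h => norm_eq_zero.mp h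
  have hfun : (fun t : ℝ => (sphereExp p (t • u) : E3)) = fun t =>
      Real.cos (k * t) • (p : E3) + (Real.sin (k * t) / k) • incl p u := funext hcurve
  have hd1 : deriv (fun t : ℝ => (sphereExp p (t • u) : E3)) = fun t =>
      (-(k * Real.sin (k * t))) • (p : E3) + Real.cos (k * t) • incl p u := by
    rw [hfun]
    funext t
    have hl : HasDerivAt (fun t : ℝ => k * t) k t := by
      simpa using (hasDerivAt_id t).const_mul k
    have h := ((hl.cos).smul_const (p : E3)).add (((hl.sin).div_const k).smul_const (incl p u))
    refine h.deriv.trans ?_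
    rcases eq_or_ne k 0 with h1 | h1
    · simp [h1, hu0 h1]
    · congr 2
      · ring
      · field_simp
  have hd2 : deriv (deriv (fun t : ℝ => (sphereExp p (t • u) : E3))) = fun t =>
      (-k ^ 2) • (sphereExp p (t • u) : E3) := by
    rw [hd1]
    funext t
    have hl : HasDerivAt (fun t : ℝ => k * t) k t := by
      simpa using (hasDerivAt_id t).const_mul k
    have h := (((hl.sin.const_mul k).neg).smul_const (p : E3)).add
      ((hl.cos).smul_const (incl p u))
    refine h.deriv.trans ?_
    rw [hcurve, smul_add, smul_smul, smul_smul]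
    rcases eq_or_ne k 0 with h1 | h1
    · simp [h1]
    · congr 2
      · ring
      · field_simp
  refine ⟨⟨?_, fun t => ⟨-k ^ 2, congrFun hd2 t⟩⟩, ?_, ?_, congrFun hd2⟩
  · rw [hfun]
    fun_prop
  · exact Subtype.ext (by rw [hcurve]; simp)
  · rw [hd1]; simp

/-- Uniqueness: a geodesic with initial point `p` and initial velocity `u` is `t ↦ Exp_p(t u)`, so
that `sphereExp` is the exponential map of the round metric. -/
theorem IsSphereGeodesic.eq_sphereExp {γ : ℝ → S2} (hγ : IsSphereGeodesic γ) (p : S2)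
    (u : TangentSpace (𝓡 2) p) (h0 : γ 0 = p)
    (h1 : deriv (fun t => (γ t : E3)) 0 = incl p u) (t : ℝ) :
    γ t = sphereExp p (t • u) := by
  obtain ⟨hF, hF0, hF1, hF2⟩ := sphereExp_curve p u
  have d1 : ∀ {f : ℝ → E3}, ContDiff ℝ ∞ f → ∀ t, HasDerivAt f (deriv f t) t :=
    fun hf t => (hf.differentiable (by simp) t).hasDerivAt
  have d2 : ∀ {f : ℝ → E3}, ContDiff ℝ ∞ f → ContDiff ℝ ∞ (deriv f) :=
    fun hf => (contDiff_infty_iff_deriv.mp hf).2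
  set g : ℝ → E3 := fun t => (γ t : E3) with hg
  set F : ℝ → E3 := fun t => (sphereExp p (t • u) : E3) with hFdef
  have hgs := hγ.smooth
  have hnorm : ∀ t, ⟪g t, g t⟫ = 1 := fun t => by
    rw [real_inner_self_eq_norm_sq, hg, norm_eq_of_mem_sphere (γ t), one_pow]
  have horth : ∀ t, ⟪g t, deriv g t⟫ = 0 := fun t => by
    have h := ((d1 hgs t).inner ℝ (d1 hgs t)).unique
      ((hasDerivAt_const t (1 : ℝ)).congr_of_eventuallyEq (.of_forall hnorm))
    rw [real_inner_comm (g t) (deriv g t)] at h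
    linarith
  have hsum : ∀ t, ⟪g t, deriv (deriv g) t⟫ + ⟪deriv g t, deriv g t⟫ = 0 := fun t =>
    ((d1 hgs t).inner ℝ (d1 (d2 hgs) t)).unique
      ((hasDerivAt_const t (0 : ℝ)).congr_of_eventuallyEq (.of_forall horth))
  have hspeed : ∀ t, ⟪deriv g t, deriv g t⟫ = tnorm p u ^ 2 := fun t => by
    have hd : ∀ t, HasDerivAt (fun t => ⟪deriv g t, deriv g t⟫) 0 t := fun t => by
      have h := (d1 (d2 hgs) t).inner ℝ (d1 (d2 hgs) t)
      obtain ⟨c, hc⟩ := hγ.accel t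
      have hc' : deriv (deriv g) t = c • g t := hc
      have e : ⟪deriv g t, deriv (deriv g) t⟫ = 0 := by
        rw [hc', inner_smul_right, real_inner_comm, horth, mul_zero]
      rwa [real_inner_comm (deriv g t) (deriv (deriv g) t), e, add_zero] at h
    have h := is_const_of_deriv_eq_zero (fun t => (hd t).differentiableAt)
      (fun t => (hd t).deriv) t 0
    rw [h, h1, real_inner_self_eq_norm_sq]; rfl
  have hode : ∀ t, deriv (deriv g) t = (-tnorm p u ^ 2) • g t := fun t => by
    obtain ⟨c, hc⟩ := hγ.accel t
    have hc' : deriv (deriv g) t = c • g t := hc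
    have h := hsum t
    rw [hc', inner_smul_right, hnorm, hspeed] at h
    rw [hc', show c = -tnorm p u ^ 2 by linarith]
  set w : ℝ → E3 := fun t => g t - F t with hw
  have hws : ContDiff ℝ ∞ w := hgs.sub hF.smooth
  have hw1 : deriv w = fun t => deriv g t - deriv F t := funext fun t =>
    ((d1 hgs t).sub (d1 hF.smooth t)).deriv
  have hw2 : ∀ t, deriv (deriv w) t = (-tnorm p u ^ 2) • w t := fun t => by
    rw [hw1]
    refine ((d1 (d2 hgs) t).sub (d1 (d2 hF.smooth) t)).deriv.trans ?_
    exact (congrArg₂ _ (hode t) (hF2 t)).trans (smul_sub _ _ _).symm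
  have hw0 : w 0 = 0 := by
    simp only [hw, hg, hFdef, h0, hF0, sub_self]
  have hw10 : deriv w 0 = 0 := by rw [hw1]; simp only [h1, hF1, sub_self]
  have henergy : ∀ t, ⟪deriv w t, deriv w t⟫ + tnorm p u ^ 2 * ⟪w t, w t⟫ = 0 := fun t => by
    have hd : ∀ t, HasDerivAt
        (fun t => ⟪deriv w t, deriv w t⟫ + tnorm p u ^ 2 * ⟪w t, w t⟫) 0 t := fun t => by
      have h := ((d1 (d2 hws) t).inner ℝ (d1 (d2 hws) t)).add
        (((d1 hws t).inner ℝ (d1 hws t)).const_mul (tnorm p u ^ 2))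
      refine h.congr_deriv ?_
      rw [hw2, inner_smul_right, inner_smul_left, real_inner_comm (w t) (deriv w t)]
      simp
      ring
    have h := is_const_of_deriv_eq_zero (fun t => (hd t).differentiableAt)
      (fun t => (hd t).deriv) t 0
    rw [h, hw0, hw10]; simp
  have hwd : ∀ t, deriv w t = 0 := fun t => by
    have h := henergy t
    have a := real_inner_self_nonneg (x := deriv w t)
    have b := mul_nonneg (sq_nonneg (tnorm p u)) (real_inner_self_nonneg (x := w t))
    exact inner_self_eq_zero (𝕜 := ℝ).mp (by linarith)
  have hwt := is_const_of_deriv_eq_zero (hws.differentiable (by simp)) hwd t 0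
  rw [hw0] at hwt
  exact Subtype.ext (sub_eq_zero.mp hwt)

/-- The map `(u, p) ↦ Exp_p((1 / |u|) arcsin(|u| / 2) u)` from `TS²` to `S²`. -/
def arcsinExp (v : TS2) : S2 :=
  sphereExp v.1 ((1 / tnorm v.1 v.2 * Real.arcsin (tnorm v.1 v.2 / 2)) • v.2)

end

noncomputable section

open Bundle Topology

section Sphere

variable {F : Type*} [NormedAddCommGroup F] [NormedSpace ℝ F] {H : Type*} [TopologicalSpace H]
  {I : ModelWithCorners ℝ F H} {M : Type*} [TopologicalSpace M] [ChartedSpace H M]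

/-- A map into the sphere is smooth at a point if it is so as a map into Euclidean space. -/
lemma contMDiffAt_sphere_of_coe {m : ℕ∞ω} {f : M → S2} {x : M}
    (hf : ContMDiffAt I 𝓘(ℝ, E3) m (fun y => (f y : E3)) x) : ContMDiffAt I (𝓡 2) m f x := by
  have := Fact.mk (@finrank_euclideanSpace_fin ℝ _ 3)
  rw [contMDiffAt_iff_target]
  refine ⟨(Topology.IsInducing.subtypeVal.continuousAt_iff).2 hf.continuousAt, ?_⟩
  set v : S2 := f x with hv
  let U := (OrthonormalBasis.fromOrthogonalSpanSingleton (𝕜 := ℝ) 2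
    (ne_zero_of_mem_unit_sphere (-v))).repr
  have hne : innerSL ℝ ((-v : S2) : E3) (v : E3) ≠ (1 : ℝ) := by
    have h : ⟪((-v : S2) : E3), (v : E3)⟫ = -1 := by simp
    rw [innerSL_apply_apply, h]
    norm_num
  have hopen : IsOpen {y : E3 | innerSL ℝ ((-v : S2) : E3) y ≠ (1 : ℝ)} :=
    isOpen_ne_fun (innerSL ℝ _).continuous continuous_const
  have h₁ : ContDiffAt ℝ m (fun y : E3 => U (stereoToFun ((-v : S2) : E3) y)) (v : E3) :=
    U.contDiff.contDiffAt.comp _ (contDiffOn_stereoToFun.contDiffAt (hopen.mem_nhds hne))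
  exact ContMDiffAt.comp (g := fun y : E3 => U (stereoToFun ((-v : S2) : E3) y)) x
    h₁.contMDiffAt hf

lemma contMDiff_coe_S2 {m : ℕ∞ω} : ContMDiff (𝓡 2) 𝓘(ℝ, E3) m (fun p : S2 => (p : E3)) := by
  have := Fact.mk (@finrank_euclideanSpace_fin ℝ _ 3)
  exact contMDiff_coe_sphere (n := 2)

/-- The tangent map of a smooth map on an open subset of a normed space is smooth. -/
lemma contMDiffOn_tangentMap_of_isOpen [IsManifold I 1 M] {V : Type*} [NormedAddCommGroup V]
    [NormedSpace ℝ V] {s : Set V} (hs : IsOpen s) {f : V → M} {m n : ℕ∞ω}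
    (hf : ContMDiffOn 𝓘(ℝ, V) I n f s) (hmn : m + 1 ≤ n) :
    ContMDiffOn 𝓘(ℝ, V × V) I.tangent m
      (fun z : V × V => tangentMap 𝓘(ℝ, V) I f ⟨z.1, z.2⟩) {z | z.1 ∈ s} := by
  have h₁ : ContMDiffOn 𝓘(ℝ, V).tangent I.tangent m (tangentMapWithin 𝓘(ℝ, V) I f s)
      (π V (TangentSpace 𝓘(ℝ, V)) ⁻¹' s) :=
    hf.contMDiffOn_tangentMapWithin hmn hs.uniqueMDiffOn
  have h₂ : ContMDiff 𝓘(ℝ, V × V) 𝓘(ℝ, V).tangent m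
      (fun z : V × V => (⟨z.1, z.2⟩ : TangentBundle 𝓘(ℝ, V) V)) := by
    have := contMDiff_tangentBundleModelSpaceHomeomorph_symm (I := 𝓘(ℝ, V)) (n := m)
    rw [modelWithCornersSelf_prod]
    exact this
  refine (h₁.comp h₂.contMDiffOn (s := {z : V × V | z.1 ∈ s}) fun z hz => hz).congr fun z hz => ?_
  refine (tangentMapWithin_eq_tangentMap (p := ⟨z.1, z.2⟩)
    (hs.uniqueMDiffOn (I := 𝓘(ℝ, V)) z.1 hz) ?_).symm
  exact (hf.contMDiffAt (hs.mem_nhds hz)).mdifferentiableAt (fun h => by simp [h] at hmn)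

end Sphere

/-- Radial projection of Euclidean space to the sphere. -/
def radial (x : E3) : S2 :=
  if h : x = 0 then ⟨EuclideanSpace.single 0 1, by simp⟩
  else ⟨‖x‖⁻¹ • x, by simp [norm_smul, h]⟩

lemma coe_radial {x : E3} (h : x ≠ 0) : (radial x : E3) = ‖x‖⁻¹ • x := by
  simp [radial, h]

@[simp]
lemma radial_coe (p : S2) : radial p = p :=
  Subtype.ext (by
    rw [coe_radial (ne_zero_of_mem_unit_sphere p), norm_eq_of_mem_sphere p, inv_one, one_smul])

lemma contMDiffAt_radial {m : ℕ∞ω} {x : E3} (h : x ≠ 0) :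
    ContMDiffAt 𝓘(ℝ, E3) (𝓡 2) m radial x := by
  refine contMDiffAt_sphere_of_coe ?_
  have h₁ : ContDiffAt ℝ m (fun x : E3 => ‖x‖⁻¹ • x) x :=
    ((contDiffAt_norm ℝ h).inv (norm_ne_zero_iff.mpr h)).smul contDiffAt_id
  refine (h₁.congr_of_eventuallyEq ?_).contMDiffAt
  filter_upwards [isOpen_ne.mem_nhds h] with y hy using coe_radial hy

lemma contMDiffOn_radial {m : ℕ∞ω} : ContMDiffOn 𝓘(ℝ, E3) (𝓡 2) m radial {x | x ≠ 0} :=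
  fun _ h => (contMDiffAt_radial h).contMDiffWithinAt

/-- The embedding `(u, p) ↦ (p, u)` of the tangent bundle of the sphere in `ℝ³ × ℝ³`. -/
def emb (v : TS2) : E3 × E3 := (v.1, incl v.1 v.2)

/-- The tangent map of the radial projection, a left inverse of `emb`. -/
def retr (z : E3 × E3) : TS2 := ⟨radial z.1, mfderiv 𝓘(ℝ, E3) (𝓡 2) radial z.1 z.2⟩

@[simp]
lemma retr_emb (v : TS2) : retr (emb v) = v := by
  have h := tangentMap_comp_at (I := 𝓡 2) (I' := 𝓘(ℝ, E3)) (I'' := 𝓡 2) (g := radial)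
    (f := fun p : S2 => (p : E3)) v
    ((contMDiffAt_radial (m := 1) (ne_zero_of_mem_unit_sphere v.1)).mdifferentiableAt one_ne_zero)
    (contMDiff_coe_S2.contMDiffAt.mdifferentiableAt (n := 1) one_ne_zero)
  have hid : radial ∘ (fun p : S2 => (p : E3)) = id := funext radial_coe
  rw [hid, tangentMap_id] at h
  exact h.symm

lemma contMDiff_emb {m : ℕ∞} : ContMDiff (𝓡 2).tangent 𝓘(ℝ, E3 × E3) m emb := by
  refine ContMDiff.prodMk_space (contMDiff_coe_S2.comp (contMDiff_proj (TangentSpace (𝓡 2)))) ?_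
  have h : ContMDiff (𝓡 2).tangent 𝓘(ℝ, E3).tangent m
      (tangentMap (𝓡 2) 𝓘(ℝ, E3) (fun p : S2 => (p : E3))) :=
    contMDiff_coe_S2.contMDiff_tangentMap (n := ω) le_top
  exact (contMDiff_snd_tangentBundle_modelSpace E3 𝓘(ℝ, E3)).comp h

lemma contMDiffAt_retr {m : ℕ∞} {z : E3 × E3} (h : z.1 ≠ 0) :
    ContMDiffAt 𝓘(ℝ, E3 × E3) (𝓡 2).tangent m retr z :=
  (contMDiffOn_tangentMap_of_isOpen isOpen_ne (contMDiffOn_radial (m := ω)) le_top).contMDiffAt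
    ((isOpen_ne.preimage continuous_fst).mem_nhds h)

/-! ### Vector identities -/

lemma inner_cross_swap (a b c : E3) : ⟪a, cross b c⟫ = -⟪b, cross a c⟫ := by
  simp [cross, PiLp.inner_apply, Fin.sum_univ_three, cross_apply]
  ring

lemma inner_self_cross_left (a b : E3) : ⟪a, cross a b⟫ = 0 := by
  rw [real_inner_comm, inner_cross_self]

lemma inner_cross_antisymm (a b c : E3) : ⟪a, cross b c⟫ = -⟪c, cross b a⟫ := by
  simp [cross, PiLp.inner_apply, Fin.sum_univ_three, cross_apply]
  ring

lemma cross_cross_self (p a : E3) : cross (cross p a) p = ⟪p, p⟫ • a - ⟪a, p⟫ • p := by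
  ext i
  fin_cases i <;>
    simp [cross, PiLp.inner_apply, Fin.sum_univ_three, cross_apply,
      -inner_self_eq_norm_sq_to_K] <;> ring

lemma cross_add_right (a b c : E3) : cross a (b + c) = cross a b + cross a c := by
  simp [cross]

lemma cross_add_left (a b c : E3) : cross (a + b) c = cross a c + cross b c := by
  simp [cross]

lemma cross_smul_right (r : ℝ) (a b : E3) : cross a (r • b) = r • cross a b := by
  simp [cross]

lemma cross_smul_left (r : ℝ) (a b : E3) : cross (r • a) b = r • cross a b := by
  simp [cross]

@[simp]
lemma cross_zero (a : E3) : cross a 0 = 0 := by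
  simp [cross]

/-- The expansion of `|x|² (y × g)` along `x` and `x × (x × (y × g))`. -/
lemma inner_self_smul_cross (x y g : E3) :
    ⟪x, x⟫ • cross y g =
      ⟪x, cross y g⟫ • x - ⟪x, g⟫ • cross x y + ⟪x, y⟫ • cross x g := by
  ext i
  fin_cases i <;>
    simp [cross, PiLp.inner_apply, Fin.sum_univ_three, cross_apply,
      -inner_self_eq_norm_sq_to_K] <;> ring

/-! ### Hamiltonian vectors on the sphere -/

lemma inner_self_sphere (p : S2) : ⟪(p : E3), (p : E3)⟫ = 1 := by
  rw [real_inner_self_eq_norm_sq, norm_eq_of_mem_sphere p, one_pow]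

lemma incl_hamVec (p : S2) (ξ : TangentSpace (𝓡 2) p →L[ℝ] ℝ) (a : E3)
    (h : ∀ u, ξ u = ⟪a, incl p u⟫) : incl p (hamVec p ξ) = cross p a := by
  have hJ : cross p a ∈ (incl p).range := by
    rw [incl_range]
    exact Submodule.mem_orthogonal_singleton_iff_inner_left.mpr (inner_cross_self _ _)
  obtain ⟨X, hX⟩ := hJ
  change incl p X = _ at hX
  suffices X = hamVec p ξ by rw [← this, hX]
  apply (LinearMap.BilinForm.toDual (areaForm p) (areaForm_nondegenerate p)).injective
  ext v
  rw [LinearMap.BilinForm.toDual_def, LinearMap.BilinForm.toDual_def, areaForm_hamVec,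
    areaForm_apply, hX, cross_cross_self, h, inner_self_sphere, one_smul, inner_sub_left,
    inner_smul_left, inner_incl, mul_zero, sub_zero]

lemma sphereBivector_apply (p : S2) (ξ ζ : TangentSpace (𝓡 2) p →L[ℝ] ℝ) (a : E3)
    (C : E3 →L[ℝ] ℝ) (h : ∀ u, ξ u = ⟪a, incl p u⟫) (h' : ∀ u, ζ u = C (incl p u)) :
    sphereBivector.toFun p ξ ζ = C (cross p a) := by
  change ζ (hamVec p ξ) = _
  rw [h', incl_hamVec p ξ a h]

/-- The differential of a function on the sphere that extends to Euclidean space. -/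
lemma mvfderiv_comp_coe {G : Type*} [NormedAddCommGroup G] [NormedSpace ℝ G] {F : E3 → G} {p : S2}
    (hF : DifferentiableAt ℝ F p) (u : TangentSpace (𝓡 2) p) :
    mvfderiv (𝓡 2) (fun x : S2 => F x) p u = fderiv ℝ F p (incl p u) := by
  have h := mfderiv_comp_apply (I := 𝓡 2) (I' := 𝓘(ℝ, E3)) (I'' := 𝓘(ℝ, G)) (g := F)
    (f := fun p : S2 => (p : E3)) p hF.mdifferentiableAt
    (contMDiff_coe_S2.contMDiffAt.mdifferentiableAt (n := 1) one_ne_zero) u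
  rw [mfderiv_eq_fderiv] at h
  exact h

/-! ### The differential of the embedding of the tangent bundle -/

/-- The differential of `emb`. -/
def demb (v : TS2) : TangentSpace (𝓡 2).tangent v →L[ℝ] E3 × E3 :=
  mvfderiv (𝓡 2).tangent emb v

lemma mdifferentiableAt_emb (v : TS2) :
    MDifferentiableAt (𝓡 2).tangent 𝓘(ℝ, E3 × E3) emb v :=
  (contMDiff_emb (m := 1)).contMDiffAt.mdifferentiableAt one_ne_zero

lemma emb_fst_ne_zero (v : TS2) : (emb v).1 ≠ 0 := ne_zero_of_mem_unit_sphere v.1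

lemma demb_injective (v : TS2) : Function.Injective (demb v) := by
  rw [injective_iff_map_eq_zero]
  intro w hw
  have h := mfderiv_comp_apply (I := (𝓡 2).tangent) (I' := 𝓘(ℝ, E3 × E3))
    (I'' := (𝓡 2).tangent) (g := retr) (f := emb) v
    ((contMDiffAt_retr (m := 1) (emb_fst_ne_zero v)).mdifferentiableAt one_ne_zero)
    (mdifferentiableAt_emb v) w
  have hw' : mfderiv (𝓡 2).tangent 𝓘(ℝ, E3 × E3) emb v w = 0 := hw
  rw [hw', map_zero] at h
  have key : ∀ f : TS2 → TS2, f = id → mfderiv (𝓡 2).tangent (𝓡 2).tangent f v w = 0 → w = 0 := by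
    rintro _ rfl h
    simpa using h
  exact key _ (funext retr_emb) h

lemma mvfderiv_comp_emb {G : Type*} [NormedAddCommGroup G] [NormedSpace ℝ G] {F : E3 × E3 → G}
    {v : TS2} (hF : DifferentiableAt ℝ F (emb v)) :
    mvfderiv (𝓡 2).tangent (fun w => F (emb w)) v = (fderiv ℝ F (emb v)).comp (demb v) := by
  ext w
  have h := mfderiv_comp_apply (I := (𝓡 2).tangent) (I' := 𝓘(ℝ, E3 × E3)) (I'' := 𝓘(ℝ, G))
    (g := F) (f := emb) v hF.mdifferentiableAt (mdifferentiableAt_emb v) w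
  rw [mfderiv_eq_fderiv] at h
  exact h

/-- The linearisation at `z = (x, y)` of the equations `|x|² = 1`, `⟨x, y⟩ = 0`. -/
def constraint (z : E3 × E3) : E3 × E3 →ₗ[ℝ] ℝ × ℝ where
  toFun w := (⟪z.1, w.1⟫, ⟪w.1, z.2⟫ + ⟪z.1, w.2⟫)
  map_add' w w' := by
    ext <;> simp [inner_add_left, inner_add_right]
    ring
  map_smul' c w := by
    ext <;> simp [inner_smul_left, inner_smul_right]
    ring

lemma inner_emb (v : TS2) : ⟪(emb v).1, (emb v).2⟫ = 0 := inner_incl v.1 v.2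

lemma inner_emb_fst (v : TS2) : ⟪(emb v).1, (emb v).1⟫ = 1 := inner_self_sphere v.1

lemma constraint_demb (v : TS2) (t : TangentSpace (𝓡 2).tangent v) :
    constraint (emb v) (demb v t) = 0 := by
  have h₁ : HasFDerivAt (fun z : E3 × E3 => ⟪z.1, z.1⟫) _ (emb v) :=
    (hasFDerivAt_fst (𝕜 := ℝ)).inner ℝ hasFDerivAt_fst
  have h₂ : HasFDerivAt (fun z : E3 × E3 => ⟪z.1, z.2⟫) _ (emb v) :=
    (hasFDerivAt_fst (𝕜 := ℝ)).inner ℝ hasFDerivAt_snd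
  have e₁ := congrArg (· t) (mvfderiv_comp_emb h₁.differentiableAt)
  have e₂ := congrArg (· t) (mvfderiv_comp_emb h₂.differentiableAt)
  rw [h₁.fderiv, funext inner_emb_fst] at e₁
  rw [h₂.fderiv, funext inner_emb] at e₂
  simp [mvfderiv_const, fderivInnerCLM_apply, real_inner_comm] at e₁ e₂
  ext
  · simp [constraint]
    linarith
  · simp [constraint, real_inner_comm (emb v).2]
    linarith

lemma finrank_ker_constraint (v : TS2) : Module.finrank ℝ (constraint (emb v)).ker = 4 := by
  have hx : ⟪(emb v).1, (emb v).1⟫ = 1 := inner_emb_fst v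
  have hs : Function.Surjective (constraint (emb v)) := by
    rintro ⟨a, b⟩
    refine ⟨(a • (emb v).1, b • (emb v).1), ?_⟩
    ext <;> simp only [constraint, LinearMap.coe_mk, AddHom.coe_mk, inner_smul_left,
      inner_smul_right, hx, inner_emb] <;> simp
  have h := (constraint (emb v)).finrank_range_add_finrank_ker
  rw [LinearMap.range_eq_top.mpr hs, finrank_top] at h
  simp at h
  omega

lemma exists_demb_eq {v : TS2} {w : E3 × E3} (hw : constraint (emb v) w = 0) :
    ∃ t, demb v t = w := by
  have hle : (demb v).range ≤ (constraint (emb v)).ker := by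
    rintro _ ⟨t, rfl⟩
    exact constraint_demb v t
  have hfin : Module.finrank ℝ (demb v).range = 4 := by
    rw [LinearMap.finrank_range_of_inj (demb_injective v)]
    change Module.finrank ℝ (EuclideanSpace ℝ (Fin 2) × EuclideanSpace ℝ (Fin 2)) = 4
    simp
  have heq := Submodule.eq_of_le_of_finrank_eq hle (by rw [hfin, finrank_ker_constraint])
  have : w ∈ (demb v).range := heq ▸ hw
  exact this

/-! ### The linear Poisson structure of the dual of the Euclidean Lie algebra -/

/-- The gradient vector of a linear form on Euclidean space. -/
def gradVec : (E3 →L[ℝ] ℝ) →ₗ[ℝ] E3 :=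
  (InnerProductSpace.toDual ℝ E3).symm.toLinearEquiv.toLinearMap

@[simp]
lemma inner_gradVec (ℓ : E3 →L[ℝ] ℝ) (w : E3) : ⟪gradVec ℓ, w⟫ = ℓ w :=
  InnerProductSpace.toDual_symm_apply

lemma gradVec_eq {ℓ : E3 →L[ℝ] ℝ} {a : E3} (h : ∀ w, ℓ w = ⟪a, w⟫) : gradVec ℓ = a :=
  ext_inner_right ℝ fun w => by rw [inner_gradVec, h]

/-- The Hamiltonian vector of a covector `ℓ` at `z = (x, y)` for the Lie-Poisson bracket
`{y_i, y_j} = ε_{ijk} y_k`, `{y_i, x_j} = ε_{ijk} x_k`, `{x_i, x_j} = 0`. -/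
def euclHamVec (z : E3 × E3) : (E3 × E3 →L[ℝ] ℝ) →ₗ[ℝ] E3 × E3 where
  toFun ℓ := (cross z.1 (gradVec (ℓ.comp (.inr ℝ E3 E3))),
    cross z.2 (gradVec (ℓ.comp (.inr ℝ E3 E3))) + cross z.1 (gradVec (ℓ.comp (.inl ℝ E3 E3))))
  map_add' ℓ ℓ' := by
    ext1 <;> simp only [ContinuousLinearMap.add_comp, map_add, cross_add_right, Prod.fst_add,
      Prod.snd_add]
    abel
  map_smul' c ℓ := by
    ext1 <;> simp only [ContinuousLinearMap.smul_comp, map_smul, cross_smul_right, Prod.smul_fst,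
      Prod.smul_snd, smul_add, RingHom.id_apply]

lemma apply_eq_inner_gradVec (ℓ : E3 × E3 →L[ℝ] ℝ) (w : E3 × E3) :
    ℓ w = ⟪gradVec (ℓ.comp (.inl ℝ E3 E3)), w.1⟫ + ⟪gradVec (ℓ.comp (.inr ℝ E3 E3)), w.2⟫ := by
  rw [inner_gradVec, inner_gradVec]
  simp [← map_add]

lemma euclHamVec_antisymm (z : E3 × E3) (ℓ m : E3 × E3 →L[ℝ] ℝ) :
    m (euclHamVec z ℓ) = -ℓ (euclHamVec z m) := by
  rw [apply_eq_inner_gradVec m, apply_eq_inner_gradVec ℓ]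
  simp only [euclHamVec, LinearMap.coe_mk, AddHom.coe_mk, inner_add_right]
  rw [inner_cross_antisymm (gradVec (m.comp (.inl ℝ E3 E3))),
    inner_cross_antisymm (gradVec (m.comp (.inr ℝ E3 E3))) z.2,
    inner_cross_antisymm (gradVec (m.comp (.inr ℝ E3 E3))) z.1]
  ring

lemma constraint_euclHamVec (z : E3 × E3) (ℓ : E3 × E3 →L[ℝ] ℝ) :
    constraint z (euclHamVec z ℓ) = 0 := by
  ext
  · simp [constraint, euclHamVec, inner_self_cross_left]
  · simp only [constraint, euclHamVec, LinearMap.coe_mk, AddHom.coe_mk, inner_add_right,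
      inner_self_cross_left, Prod.snd_zero]
    rw [real_inner_comm, inner_cross_swap z.2]
    ring

/-- A left inverse of the differential of `emb`. -/
def dembInv (v : TS2) : E3 × E3 →L[ℝ] TangentSpace (𝓡 2).tangent v :=
  LinearMap.toContinuousLinearMap
    ((demb v).toLinearMap.exists_leftInverse_of_injective
      (LinearMap.ker_eq_bot.mpr (demb_injective v))).choose

lemma dembInv_demb (v : TS2) (t : TangentSpace (𝓡 2).tangent v) : dembInv v (demb v t) = t :=
  LinearMap.congr_fun ((demb v).toLinearMap.exists_leftInverse_of_injective
    (LinearMap.ker_eq_bot.mpr (demb_injective v))).choose_spec t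

lemma demb_dembInv {v : TS2} {w : E3 × E3} (hw : constraint (emb v) w = 0) :
    demb v (dembInv v w) = w := by
  obtain ⟨t, rfl⟩ := exists_demb_eq hw
  rw [dembInv_demb]

/-- The bivector field on the tangent bundle of the sphere induced by the Lie-Poisson structure of
the dual of the Euclidean Lie algebra. -/
def tangentBivector : BivectorField (𝓡 2).tangent TS2 where
  toFun v := LinearMap.mk₂ ℝ
    (fun ξ ζ => ζ (dembInv v (euclHamVec (emb v) (ξ.comp (dembInv v)))))
    (fun _ _ _ => by simp [ContinuousLinearMap.add_comp])
    (fun _ _ _ => by simp [ContinuousLinearMap.smul_comp])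
    (fun _ _ _ => by simp) (fun _ _ _ => by simp)
  alt v ξ := by
    have h := euclHamVec_antisymm (emb v) (ξ.comp (dembInv v)) (ξ.comp (dembInv v))
    rw [LinearMap.mk₂_apply]
    simp only [ContinuousLinearMap.comp_apply] at h
    linarith

lemma tangentBivector_comp_demb (v : TS2) (ℓ m : E3 × E3 →L[ℝ] ℝ) :
    tangentBivector.toFun v (ℓ.comp (demb v)) (m.comp (demb v)) = m (euclHamVec (emb v) ℓ) := by
  change m (demb v (dembInv v (euclHamVec (emb v) ((ℓ.comp (demb v)).comp (dembInv v))))) = _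
  rw [demb_dembInv (constraint_euclHamVec _ _), euclHamVec_antisymm, euclHamVec_antisymm _ _ m]
  simp only [ContinuousLinearMap.comp_apply]
  rw [demb_dembInv (constraint_euclHamVec _ _)]

/-- The bracket of two functions on the tangent bundle that extend to `ℝ³ × ℝ³`. -/
lemma tangentBivector_bracket {F G : E3 × E3 → ℝ} {f g : TS2 → ℝ} {v : TS2}
    (hF : DifferentiableAt ℝ F (emb v)) (hG : DifferentiableAt ℝ G (emb v))
    (hf : f =ᶠ[𝓝 v] fun w => F (emb w)) (hg : g =ᶠ[𝓝 v] fun w => G (emb w)) :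
    tangentBivector.bracket f g v =
      fderiv ℝ G (emb v) (euclHamVec (emb v) (fderiv ℝ F (emb v))) := by
  have e : ∀ {f f' : TS2 → ℝ}, f =ᶠ[𝓝 v] f' →
      mvfderiv (𝓡 2).tangent f v = mvfderiv (𝓡 2).tangent f' v := by
    intro f f' h
    ext t
    exact congrArg (fun L => L t) (h.mfderiv_eq (I := (𝓡 2).tangent) (I' := 𝓘(ℝ, ℝ)))
  rw [BivectorField.bracket, e hf, e hg, mvfderiv_comp_emb hF, mvfderiv_comp_emb hG,
    tangentBivector_comp_demb]

/-! ### Closed one-forms on the sphere -/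

/-- The pull-back of a `1`-form on the sphere by the radial projection. -/
def radialForm (α : ∀ p : S2, TangentSpace (𝓡 2) p →L[ℝ] ℝ) (x : E3) : E3 →L[ℝ] ℝ :=
  (α (radial x)).comp (mfderiv 𝓘(ℝ, E3) (𝓡 2) radial x)

lemma tilde_eq_radialForm (α : ∀ p : S2, TangentSpace (𝓡 2) p →L[ℝ] ℝ) (v : TS2) :
    tilde α v = radialForm α (emb v).1 (emb v).2 := by
  conv_lhs => rw [← retr_emb v]
  rfl

lemma apply_eq_radialForm (α : ∀ p : S2, TangentSpace (𝓡 2) p →L[ℝ] ℝ) (p : S2)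
    (u : TangentSpace (𝓡 2) p) : α p u = radialForm α p (incl p u) :=
  tilde_eq_radialForm α ⟨p, u⟩

lemma IsClosedOneForm.contDiffAt_radialForm {α : ∀ p : S2, TangentSpace (𝓡 2) p →L[ℝ] ℝ}
    (hα : IsClosedOneForm α) {x : E3} (hx : x ≠ 0) : ContDiffAt ℝ ∞ (radialForm α) x := by
  suffices ContDiffOn ℝ ∞ (radialForm α) {x | x ≠ 0} from this.contDiffAt (isOpen_ne.mem_nhds hx)
  refine contDiffOn_clm_apply.mpr fun y x hx => ContDiffAt.contDiffWithinAt ?_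
  have h₁ : ContMDiffAt 𝓘(ℝ, E3) 𝓘(ℝ, E3 × E3) ∞ (fun x : E3 => (x, y)) x :=
    (contDiffAt_id.prodMk contDiffAt_const).contMDiffAt
  have h₂ := (hα.smooth.contMDiffAt.comp (x, y) (contMDiffAt_retr (z := (x, y)) hx)).comp x h₁
  exact h₂.contDiffAt

lemma range_modelWithCorners_S2 : Set.range (𝓡 2) = Set.univ := (𝓡 2).range_eq_univ

lemma isOpen_extChartAt_target_S2 (p : S2) : IsOpen (extChartAt (𝓡 2) p).target :=
  isOpen_extChartAt_target p

lemma formInChart_apply (α : ∀ p : S2, TangentSpace (𝓡 2) p →L[ℝ] ℝ) (p : S2)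
    (y w : EuclideanSpace ℝ (Fin 2)) :
    formInChart α p y w = tilde α (tangentMap 𝓘(ℝ, EuclideanSpace ℝ (Fin 2)) (𝓡 2)
      (extChartAt (𝓡 2) p).symm ⟨y, w⟩) := by
  rw [formInChart, range_modelWithCorners_S2, mfderivWithin_univ]
  rfl

lemma IsClosedOneForm.contDiffAt_formInChart {α : ∀ p : S2, TangentSpace (𝓡 2) p →L[ℝ] ℝ}
    (hα : IsClosedOneForm α) (p : S2) {y : EuclideanSpace ℝ (Fin 2)}
    (hy : y ∈ (extChartAt (𝓡 2) p).target) : ContDiffAt ℝ ∞ (formInChart α p) y := by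
  have ho := isOpen_extChartAt_target_S2 p
  suffices ContDiffOn ℝ ∞ (formInChart α p) (extChartAt (𝓡 2) p).target from
    this.contDiffAt (ho.mem_nhds hy)
  refine contDiffOn_clm_apply.mpr fun w => ?_
  have h₀ := contMDiffOn_tangentMap_of_isOpen (m := (∞ : ℕ∞ω)) ho
    (contMDiffOn_extChartAt_symm (n := ω) p) le_top
  have h₁ : ContMDiff 𝓘(ℝ, EuclideanSpace ℝ (Fin 2))
      𝓘(ℝ, EuclideanSpace ℝ (Fin 2) × EuclideanSpace ℝ (Fin 2)) ∞
      (fun y : EuclideanSpace ℝ (Fin 2) => (y, w)) :=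
    (contDiff_id.prodMk contDiff_const).contMDiff
  have h₂ := (hα.smooth.comp_contMDiffOn h₀).comp (h₁.contMDiffOn (s := (extChartAt (𝓡 2) p).target))
    fun y hy => hy
  exact h₂.contDiffOn.congr fun y _ => formInChart_apply α p y w

/-- The derivative of the pull-back of a `1`-form on a normed space. -/
lemma fderiv_pullback_apply {V W : Type*} [NormedAddCommGroup V] [NormedSpace ℝ V]
    [NormedAddCommGroup W] [NormedSpace ℝ W] {β : W → W →L[ℝ] ℝ} {ρ : V → W} {x : V}
    (hβ : DifferentiableAt ℝ β (ρ x)) (hρ : ContDiffAt ℝ 2 ρ x) (a b : V) :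
    fderiv ℝ (fun x => (β (ρ x)).comp (fderiv ℝ ρ x)) x a b =
      fderiv ℝ β (ρ x) (fderiv ℝ ρ x a) (fderiv ℝ ρ x b) +
        β (ρ x) (fderiv ℝ (fderiv ℝ ρ) x a b) := by
  have h₁ : DifferentiableAt ℝ ρ x := hρ.differentiableAt (by simp)
  have h₂ : DifferentiableAt ℝ (fderiv ℝ ρ) x :=
    (hρ.fderiv_right (m := 1) (by norm_num)).differentiableAt (by simp)
  have h := ((hβ.hasFDerivAt.comp x h₁.hasFDerivAt).clm_comp h₂.hasFDerivAt).fderiv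
  refine (congrArg (fun L => L a b) h).trans ?_
  simp [add_comm]

/-- The local coordinates of the radial projection of `x`, in the chart at `p`. -/
def radialCoord (p : S2) (x : E3) : EuclideanSpace ℝ (Fin 2) := extChartAt (𝓡 2) p (radial x)

lemma isOpen_radialCoord_domain (p : S2) :
    IsOpen ({x : E3 | x ≠ 0} ∩ radial ⁻¹' (extChartAt (𝓡 2) p).source) :=
  (contMDiffOn_radial (m := 1)).continuousOn.isOpen_inter_preimage isOpen_ne
    (isOpen_extChartAt_source p)

lemma mem_radialCoord_domain (p : S2) :
    (p : E3) ∈ {x : E3 | x ≠ 0} ∩ radial ⁻¹' (extChartAt (𝓡 2) p).source :=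
  ⟨ne_zero_of_mem_unit_sphere p, by simp⟩

lemma contDiffAt_radialCoord {p : S2} {x : E3}
    (hx : x ∈ {x : E3 | x ≠ 0} ∩ radial ⁻¹' (extChartAt (𝓡 2) p).source) {n : ℕ∞ω} :
    ContDiffAt ℝ n (radialCoord p) x :=
  ((contMDiffAt_extChartAt' (n := n) (by simpa using hx.2)).comp x
    (contMDiffAt_radial hx.1)).contDiffAt

lemma radialForm_eventuallyEq (α : ∀ p : S2, TangentSpace (𝓡 2) p →L[ℝ] ℝ) (p : S2) :
    radialForm α =ᶠ[𝓝 (p : E3)]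
      fun x => (formInChart α p (radialCoord p x)).comp (fderiv ℝ (radialCoord p) x) := by
  set φ := extChartAt (𝓡 2) p
  have hopen := isOpen_radialCoord_domain p
  filter_upwards [hopen.mem_nhds (mem_radialCoord_domain p)] with x hx
  ext y
  rw [ContinuousLinearMap.comp_apply, formInChart_apply]
  have hd : MDifferentiableAt 𝓘(ℝ, E3) 𝓘(ℝ, EuclideanSpace ℝ (Fin 2)) (radialCoord p) x :=
    ((contDiffAt_radialCoord (n := 1) hx).differentiableAt one_ne_zero).mdifferentiableAt
  have ht : radialCoord p x ∈ φ.target := φ.map_source hx.2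
  have hd' : MDifferentiableAt 𝓘(ℝ, EuclideanSpace ℝ (Fin 2)) (𝓡 2) φ.symm (radialCoord p x) :=
    ((contMDiffOn_extChartAt_symm (n := 1) p).contMDiffAt
      ((isOpen_extChartAt_target_S2 p).mem_nhds ht)).mdifferentiableAt one_ne_zero
  have h₁ := tangentMap_comp_at (I := 𝓘(ℝ, E3)) (I' := 𝓘(ℝ, EuclideanSpace ℝ (Fin 2)))
    (I'' := 𝓡 2) (g := φ.symm) (f := radialCoord p) ⟨x, y⟩ hd' hd
  have hu : UniqueMDiffWithinAt 𝓘(ℝ, E3) ({x : E3 | x ≠ 0} ∩ radial ⁻¹' φ.source) x :=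
    hopen.uniqueMDiffOn x hx
  have h₂ := tangentMapWithin_congr (I := 𝓘(ℝ, E3)) (I' := 𝓡 2) (f := radial)
    (f₁ := φ.symm ∘ radialCoord p) (s := ({x : E3 | x ≠ 0} ∩ radial ⁻¹' φ.source))
    (fun x hx => (φ.left_inv hx.2).symm) ⟨x, y⟩ hx
  rw [tangentMapWithin_eq_tangentMap (p := ⟨x, y⟩) hu
      ((contMDiffAt_radial (m := 1) hx.1).mdifferentiableAt one_ne_zero),
    tangentMapWithin_eq_tangentMap (p := ⟨x, y⟩) hu (MDifferentiableAt.comp x hd' hd), h₁] at h₂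
  have h₃ : tangentMap 𝓘(ℝ, E3) 𝓘(ℝ, EuclideanSpace ℝ (Fin 2)) (radialCoord p) ⟨x, y⟩ =
      ⟨radialCoord p x, fderiv ℝ (radialCoord p) x y⟩ := by
    simp only [tangentMap, mfderiv_eq_fderiv]
    rfl
  rw [h₃] at h₂
  exact congrArg (tilde α) h₂

lemma fderiv_radialForm_symm {α : ∀ p : S2, TangentSpace (𝓡 2) p →L[ℝ] ℝ}
    (hα : IsClosedOneForm α) (p : S2) (u w : E3) :
    fderiv ℝ (radialForm α) p u w = fderiv ℝ (radialForm α) p w u := by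
  have hmem := mem_radialCoord_domain p
  have ht : radialCoord p p ∈ (extChartAt (𝓡 2) p).target :=
    (extChartAt (𝓡 2) p).map_source hmem.2
  have hρ := contDiffAt_radialCoord (n := 2) hmem
  have hβ := (hα.contDiffAt_formInChart p ht).differentiableAt (by simp)
  have hcl := hα.closed p (radialCoord p p) ht
  simp only [range_modelWithCorners_S2, fderivWithin_univ] at hcl
  rw [(radialForm_eventuallyEq α p).fderiv_eq, fderiv_pullback_apply hβ hρ,
    fderiv_pullback_apply hβ hρ, hcl, hρ.isSymmSndFDerivAt (by simp) u w]

lemma mvfderiv_inner (c : E3) (p : S2) (u : TangentSpace (𝓡 2) p) :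
    mvfderiv (𝓡 2) (fun p : S2 => ⟪c, (p : E3)⟫) p u = ⟪c, incl p u⟫ := by
  rw [mvfderiv_comp_coe (F := fun x => ⟪c, x⟫) (innerSL ℝ c).differentiableAt]
  exact congrArg (fun L => L (incl p u)) (innerSL ℝ c).fderiv

lemma contMDiff_inner_coe (c : E3) {n : ℕ∞ω} :
    ContMDiff (𝓡 2) 𝓘(ℝ, ℝ) n (fun p : S2 => ⟪c, (p : E3)⟫) :=
  (innerSL ℝ c).contDiff.contMDiff.comp contMDiff_coe_S2

/-- The differential of a linear function on the sphere is a closed `1`-form. -/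
lemma isClosedOneForm_inner (c : E3) :
    IsClosedOneForm (mvfderiv (𝓡 2) (fun p : S2 => ⟪c, (p : E3)⟫)) := by
  constructor
  · have h : ContMDiff (𝓡 2).tangent 𝓘(ℝ, ℝ) ∞ (fun v : TS2 => ⟪c, (emb v).2⟫) :=
      ((innerSL ℝ c).contDiff.comp contDiff_snd).contMDiff.comp (contMDiff_emb (m := ⊤))
    exact h.congr fun v => mvfderiv_inner c v.1 v.2
  · intro p y hy v w
    set f : EuclideanSpace ℝ (Fin 2) → ℝ := fun y => ⟪c, ((extChartAt (𝓡 2) p).symm y : E3)⟫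
    have ho := isOpen_extChartAt_target_S2 p
    have hsymm : ∀ y ∈ (extChartAt (𝓡 2) p).target, ContMDiffAt 𝓘(ℝ, EuclideanSpace ℝ (Fin 2))
        (𝓡 2) 2 (extChartAt (𝓡 2) p).symm y := fun y hy =>
      (contMDiffOn_extChartAt_symm p).contMDiffAt (ho.mem_nhds hy)
    have hf : ContDiffAt ℝ 2 f y :=
      ((innerSL ℝ c).contDiff.contMDiff.contMDiffAt.comp y
        (contMDiff_coe_S2.contMDiffAt.comp y (hsymm y hy))).contDiffAt
    have heq : formInChart (mvfderiv (𝓡 2) (fun p : S2 => ⟪c, (p : E3)⟫)) p =ᶠ[𝓝 y]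
        fderiv ℝ f := by
      filter_upwards [ho.mem_nhds hy] with z hz
      ext t
      have hd : MDifferentiableAt (𝓡 2) 𝓘(ℝ, ℝ) (fun p : S2 => ⟪c, (p : E3)⟫)
          ((extChartAt (𝓡 2) p).symm z) :=
        (contMDiff_inner_coe c (n := 1)).contMDiffAt.mdifferentiableAt one_ne_zero
      have h := mfderiv_comp_apply z hd ((hsymm z hz).mdifferentiableAt two_ne_zero) t
      rw [formInChart_apply, ← mfderiv_eq_fderiv]
      exact h.symm
    simp only [range_modelWithCorners_S2, fderivWithin_univ]
    rw [heq.fderiv_eq]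
    exact hf.isSymmSndFDerivAt (by simp) v w

/-! ### Existence and uniqueness of the Poisson structure of the tangent bundle -/

/-- The cross product as a continuous bilinear map. -/
def crossL : E3 →L[ℝ] E3 →L[ℝ] E3 :=
  LinearMap.toContinuousLinearMap (LinearMap.toContinuousLinearMap.toLinearMap ∘ₗ
    LinearMap.mk₂ ℝ cross cross_add_left cross_smul_left cross_add_right
      fun r a b => cross_smul_right r a b)

lemma crossL_apply (a b : E3) : crossL a b = cross a b := rfl

lemma contDiffAt_comp_radial {f : S2 → ℝ} (hf : ContMDiff (𝓡 2) 𝓘(ℝ, ℝ) ∞ f) {x : E3}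
    (hx : x ≠ 0) : ContDiffAt ℝ ∞ (fun x => f (radial x)) x :=
  (hf.contMDiffAt.comp x (contMDiffAt_radial hx)).contDiffAt

lemma differentiableAt_comp_radial {f : S2 → ℝ} (hf : ContMDiff (𝓡 2) 𝓘(ℝ, ℝ) ∞ f) (p : S2) :
    DifferentiableAt ℝ (fun x => f (radial x)) p :=
  (contDiffAt_comp_radial hf (ne_zero_of_mem_unit_sphere p)).differentiableAt (by simp)

lemma mvfderiv_eq_fderiv_radial {f : S2 → ℝ} (hf : ContMDiff (𝓡 2) 𝓘(ℝ, ℝ) ∞ f) (p : S2)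
    (u : TangentSpace (𝓡 2) p) :
    mvfderiv (𝓡 2) f p u = fderiv ℝ (fun x => f (radial x)) p (incl p u) := by
  rw [← mvfderiv_comp_coe (differentiableAt_comp_radial hf p)]
  simp only [radial_coe]

lemma sphereBivector_bracket {f g : S2 → ℝ} (hf : ContMDiff (𝓡 2) 𝓘(ℝ, ℝ) ∞ f)
    (hg : ContMDiff (𝓡 2) 𝓘(ℝ, ℝ) ∞ g) (p : S2) :
    sphereBivector.bracket f g p = fderiv ℝ (fun x => g (radial x)) p
      (cross p (gradVec (fderiv ℝ (fun x => f (radial x)) p))) :=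
  sphereBivector_apply p _ _ _ _
    (fun u => by rw [mvfderiv_eq_fderiv_radial hf, inner_gradVec]) (mvfderiv_eq_fderiv_radial hg p)

lemma hasFDerivAt_tilde {A : E3 → E3 →L[ℝ] ℝ} {z : E3 × E3} (hA : DifferentiableAt ℝ A z.1) :
    HasFDerivAt (fun z : E3 × E3 => A z.1 z.2)
      ((A z.1).comp (.snd ℝ E3 E3) + ((fderiv ℝ A z.1).comp (.fst ℝ E3 E3)).flip z.2) z :=
  (hA.hasFDerivAt.comp z hasFDerivAt_fst).clm_apply hasFDerivAt_snd

lemma hasFDerivAt_comp_radial_fst {f : S2 → ℝ} (hf : ContMDiff (𝓡 2) 𝓘(ℝ, ℝ) ∞ f) (v : TS2) :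
    HasFDerivAt (fun z : E3 × E3 => f (radial z.1))
      ((fderiv ℝ (fun x => f (radial x)) v.1).comp (.fst ℝ E3 E3)) (emb v) :=
  HasFDerivAt.comp (g := fun x => f (radial x)) (f := Prod.fst) (emb v)
    (differentiableAt_comp_radial hf v.1).hasFDerivAt hasFDerivAt_fst

lemma IsClosedOneForm.differentiableAt_radialForm
    {α : ∀ p : S2, TangentSpace (𝓡 2) p →L[ℝ] ℝ} (hα : IsClosedOneForm α) (p : S2) :
    DifferentiableAt ℝ (radialForm α) p :=
  (hα.contDiffAt_radialForm (ne_zero_of_mem_unit_sphere p)).differentiableAt (by simp)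

/-- The Hamiltonian vector of the function defined by a closed `1`-form. -/
lemma euclHamVec_tilde {α : ∀ p : S2, TangentSpace (𝓡 2) p →L[ℝ] ℝ} (hα : IsClosedOneForm α)
    (v : TS2) :
    euclHamVec (emb v) (fderiv ℝ (fun z : E3 × E3 => radialForm α z.1 z.2) (emb v)) =
      (cross v.1 (gradVec (radialForm α v.1)),
        cross (incl v.1 v.2) (gradVec (radialForm α v.1)) +
          cross v.1 (gradVec (fderiv ℝ (radialForm α) v.1 (incl v.1 v.2)))) := by
  have h := (hasFDerivAt_tilde (z := emb v) (hα.differentiableAt_radialForm v.1)).fderiv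
  rw [h]
  have h₁ : ∀ ℓ : E3 × E3 →L[ℝ] ℝ, ℓ = ((radialForm α (emb v).1).comp (.snd ℝ E3 E3) +
      ((fderiv ℝ (radialForm α) (emb v).1).comp (.fst ℝ E3 E3)).flip (emb v).2) →
      ℓ.comp (.inr ℝ E3 E3) = radialForm α v.1 ∧
      ℓ.comp (.inl ℝ E3 E3) = fderiv ℝ (radialForm α) v.1 (incl v.1 v.2) := by
    rintro _ rfl
    constructor
    · ext w
      simp [emb]
    · ext w
      simp [emb, fderiv_radialForm_symm hα v.1 w]
  obtain ⟨h₂, h₃⟩ := h₁ _ rfl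
  simp only [euclHamVec, LinearMap.coe_mk, AddHom.coe_mk]
  rw [h₂, h₃]
  rfl

lemma pairing_sphereBivector (α β : ∀ p : S2, TangentSpace (𝓡 2) p →L[ℝ] ℝ) (p : S2) :
    sphereBivector.pairing α β p =
      radialForm β p (crossL p (gradVec.toContinuousLinearMap (radialForm α p))) :=
  sphereBivector_apply p _ _ _ _
    (fun u => by
      rw [LinearMap.coe_toContinuousLinearMap', inner_gradVec, apply_eq_radialForm])
    (apply_eq_radialForm β p)

theorem isTangentPoisson_tangentBivector : IsTangentPoisson sphereBivector tangentBivector where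
  tilde_tilde α β hα hβ v := by
    have hA := hα.differentiableAt_radialForm v.1
    have hC := hβ.differentiableAt_radialForm v.1
    have hF := hasFDerivAt_tilde (z := emb v) hA
    have hG := hasFDerivAt_tilde (z := emb v) hC
    rw [tangentBivector_bracket hF.differentiableAt hG.differentiableAt
      (.of_forall (tilde_eq_radialForm α)) (.of_forall (tilde_eq_radialForm β)),
      euclHamVec_tilde hα, hG.fderiv, closedFormBracket, funext (pairing_sphereBivector α β)]
    have hP := hC.hasFDerivAt.clm_apply ((crossL.hasFDerivAt (x := (v.1 : E3))).clm_apply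
      ((gradVec.toContinuousLinearMap.hasFDerivAt).comp (v.1 : E3) hA.hasFDerivAt))
    refine Eq.trans ?_ (mvfderiv_comp_coe hP.differentiableAt v.2).symm
    rw [hP.fderiv]
    have hsymm := fderiv_radialForm_symm hβ v.1 (incl v.1 v.2)
      (cross v.1 (gradVec (radialForm α v.1)))
    simp [emb, crossL_apply, hsymm]
    ring
  pull_pull f g hf hg v := by
    have hF := hasFDerivAt_comp_radial_fst hf v
    have hG := hasFDerivAt_comp_radial_fst hg v
    rw [tangentBivector_bracket hF.differentiableAt hG.differentiableAt
      (.of_forall fun w => by simp [emb]) (.of_forall fun w => by simp [emb]), hF.fderiv, hG.fderiv]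
    have h : ((fderiv ℝ (fun x => f (radial x)) v.1).comp (.fst ℝ E3 E3)).comp (.inr ℝ E3 E3) =
        0 := by
      ext
      simp
    simp [euclHamVec, h]
  tilde_pull α f hα hf v := by
    have hF := hasFDerivAt_tilde (z := emb v) (hα.differentiableAt_radialForm v.1)
    have hG := hasFDerivAt_comp_radial_fst hf v
    rw [tangentBivector_bracket hF.differentiableAt hG.differentiableAt
      (.of_forall (tilde_eq_radialForm α)) (.of_forall fun w => by simp [emb]),
      euclHamVec_tilde hα, hG.fderiv]
    exact (sphereBivector_apply v.1 _ _ _ _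
      (fun u => by rw [inner_gradVec, apply_eq_radialForm]) (mvfderiv_eq_fderiv_radial hf v.1)).symm

/-- Every covector of the tangent bundle is the sum of the differentials at `v` of a function on
the base and of the fibrewise linear function of an exact form. -/
lemma exists_covector_eq (v : TS2) (ξ : TangentSpace (𝓡 2).tangent v →L[ℝ] ℝ) :
    ∃ c d : E3, ξ = mvfderiv (𝓡 2).tangent (fun w : TS2 => ⟪c, (w.1 : E3)⟫) v +
      mvfderiv (𝓡 2).tangent (tilde (mvfderiv (𝓡 2) (fun p : S2 => ⟪d, (p : E3)⟫))) v := by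
  set ℓ := ξ.comp (dembInv v)
  refine ⟨gradVec (ℓ.comp (.inl ℝ E3 E3)), gradVec (ℓ.comp (.inr ℝ E3 E3)), ?_⟩
  have h₁ : ∀ c : E3, mvfderiv (𝓡 2).tangent (fun w : TS2 => ⟪c, (w.1 : E3)⟫) v =
      ((innerSL ℝ c).comp (.fst ℝ E3 E3)).comp (demb v) := fun c => by
    have := mvfderiv_comp_emb (v := v) ((innerSL ℝ c).comp (.fst ℝ E3 E3)).differentiableAt
    rw [ContinuousLinearMap.fderiv] at this
    exact this
  have h₂ : ∀ d : E3, mvfderiv (𝓡 2).tangent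
      (tilde (mvfderiv (𝓡 2) (fun p : S2 => ⟪d, (p : E3)⟫))) v =
      ((innerSL ℝ d).comp (.snd ℝ E3 E3)).comp (demb v) := fun d => by
    have := mvfderiv_comp_emb (v := v) ((innerSL ℝ d).comp (.snd ℝ E3 E3)).differentiableAt
    rw [ContinuousLinearMap.fderiv] at this
    rw [← this]
    congr 1
    funext w
    exact mvfderiv_inner d w.1 w.2
  rw [h₁, h₂]
  ext t
  have h := apply_eq_inner_gradVec ℓ (demb v t)
  simp only [ℓ, ContinuousLinearMap.comp_apply, dembInv_demb] at h
  simpa [ℓ] using h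

lemma IsTangentPoisson.eq {Λ Λ' : BivectorField (𝓡 2).tangent TS2}
    (h : IsTangentPoisson sphereBivector Λ) (h' : IsTangentPoisson sphereBivector Λ') :
    Λ = Λ' := by
  have anti : ∀ (Λ : BivectorField (𝓡 2).tangent TS2) (f g : TS2 → ℝ) (v : TS2),
      Λ.bracket f g v = -Λ.bracket g f v := by
    intro Λ f g v
    have h := Λ.alt v (mvfderiv (𝓡 2).tangent f v + mvfderiv (𝓡 2).tangent g v)
    simp only [map_add, LinearMap.add_apply, Λ.alt] at h
    simp only [BivectorField.bracket]
    linarith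
  ext v ξ ζ
  obtain ⟨c, d, rfl⟩ := exists_covector_eq v ξ
  obtain ⟨c', d', rfl⟩ := exists_covector_eq v ζ
  have e₁ := (h.pull_pull _ _ (contMDiff_inner_coe c) (contMDiff_inner_coe c') v).trans
    (h'.pull_pull _ _ (contMDiff_inner_coe c) (contMDiff_inner_coe c') v).symm
  have e₂ := (h.tilde_tilde _ _ (isClosedOneForm_inner d) (isClosedOneForm_inner d') v).trans
    (h'.tilde_tilde _ _ (isClosedOneForm_inner d) (isClosedOneForm_inner d') v).symm
  have e₃ := (h.tilde_pull _ _ (isClosedOneForm_inner d) (contMDiff_inner_coe c') v).trans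
    (h'.tilde_pull _ _ (isClosedOneForm_inner d) (contMDiff_inner_coe c') v).symm
  have e₄ := (h.tilde_pull _ _ (isClosedOneForm_inner d') (contMDiff_inner_coe c) v).trans
    (h'.tilde_pull _ _ (isClosedOneForm_inner d') (contMDiff_inner_coe c) v).symm
  rw [anti Λ, anti Λ', neg_inj] at e₄
  simp only [map_add, LinearMap.add_apply]
  exact congrArg₂ (· + ·) (congrArg₂ (· + ·) e₁ e₃) (congrArg₂ (· + ·) e₄ e₂)

/-! ### The Poisson map -/

/-- The expression of `arcsinExp` in `ℝ³ × ℝ³`. -/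
def arcsinExpAux (z : E3 × E3) : E3 := √(1 - ⟪z.2, z.2⟫ / 4) • z.1 + (1 / 2 : ℝ) • z.2

lemma coe_arcsinExp {v : TS2} (hv : tnorm v.1 v.2 < 2) :
    (arcsinExp v : E3) = arcsinExpAux (emb v) := by
  set k := tnorm v.1 v.2 with hk
  have hk0 : 0 ≤ k := norm_nonneg _
  have hin : ⟪incl v.1 v.2, incl v.1 v.2⟫ = k ^ 2 := real_inner_self_eq_norm_sq _
  have hn : tnorm v.1 ((1 / k * Real.arcsin (k / 2)) • v.2) = Real.arcsin (k / 2) := by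
    have h0 : 0 ≤ Real.arcsin (k / 2) := Real.arcsin_nonneg.mpr (by positivity)
    rw [tnorm, map_smul, norm_smul, Real.norm_eq_abs, abs_of_nonneg (by positivity)]
    change 1 / k * _ * k = _
    rcases eq_or_ne k 0 with h | h
    · simp [h]
    · field_simp
  change Real.cos (tnorm v.1 ((1 / k * Real.arcsin (k / 2)) • v.2)) • (v.1 : E3) +
    (Real.sin (tnorm v.1 ((1 / k * Real.arcsin (k / 2)) • v.2)) /
      tnorm v.1 ((1 / k * Real.arcsin (k / 2)) • v.2)) •
      incl v.1 ((1 / k * Real.arcsin (k / 2)) • v.2) =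
    √(1 - ⟪incl v.1 v.2, incl v.1 v.2⟫ / 4) • (v.1 : E3) + (1 / 2 : ℝ) • incl v.1 v.2
  rw [hn, hin, Real.cos_arcsin, Real.sin_arcsin (by linarith) (by linarith), map_smul, smul_smul,
    show 1 - (k / 2) ^ 2 = 1 - k ^ 2 / 4 by ring]
  congr 1
  rcases eq_or_ne k 0 with h | h
  · have h0 : incl v.1 v.2 = 0 := norm_eq_zero.mp h
    simp [h0]
  · have ha : Real.arcsin (k / 2) ≠ 0 := by
      rw [Ne, Real.arcsin_eq_zero_iff]
      simpa using h
    congr 1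
    field_simp

lemma continuous_tnorm : Continuous fun v : TS2 => tnorm v.1 v.2 :=
  (continuous_snd.comp (contMDiff_emb (m := 0)).continuous).norm

lemma isOpen_tnorm_lt (r : ℝ) : IsOpen {v : TS2 | tnorm v.1 v.2 < r} :=
  isOpen_lt continuous_tnorm continuous_const

lemma one_sub_inner_pos {v : TS2} (hv : tnorm v.1 v.2 < 2) :
    0 < 1 - ⟪(emb v).2, (emb v).2⟫ / 4 := by
  have h : ⟪(emb v).2, (emb v).2⟫ = tnorm v.1 v.2 ^ 2 := real_inner_self_eq_norm_sq _
  have h0 : 0 ≤ tnorm v.1 v.2 := norm_nonneg _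
  rw [h]
  nlinarith

lemma contDiffAt_arcsinExpAux {n : ℕ∞ω} {z : E3 × E3} (hz : 0 < 1 - ⟪z.2, z.2⟫ / 4) :
    ContDiffAt ℝ n arcsinExpAux z := by
  have h : ContDiffAt ℝ n (fun z : E3 × E3 => 1 - ⟪z.2, z.2⟫ / 4) z :=
    contDiffAt_const.sub ((contDiffAt_snd.inner ℝ contDiffAt_snd).div_const 4)
  exact ((h.sqrt hz.ne').smul contDiffAt_fst).add (contDiffAt_snd.const_smul (1 / 2 : ℝ))

lemma fderiv_arcsinExpAux {z : E3 × E3} (hz : 0 < 1 - ⟪z.2, z.2⟫ / 4) {s : ℝ}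
    (hs : √(1 - ⟪z.2, z.2⟫ / 4) = s) (w : E3 × E3) :
    fderiv ℝ arcsinExpAux z w =
      s • w.1 - (⟪z.2, w.2⟫ / (4 * s)) • z.1 + (1 / 2 : ℝ) • w.2 := by
  have hi : HasFDerivAt (fun z : E3 × E3 => 1 - ⟪z.2, z.2⟫ / 4)
      (-((1 / 2 : ℝ) • (innerSL ℝ z.2).comp (.snd ℝ E3 E3))) z := by
    have h := (((hasFDerivAt_snd (𝕜 := ℝ) (p := z)).inner ℝ hasFDerivAt_snd).mul_const
      (1 / 4 : ℝ)).const_sub 1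
    simp only [mul_one_div] at h
    refine h.congr_fderiv ?_
    ext w <;> simp [fderivInnerCLM_apply, real_inner_comm z.2]
    ring
  have h := ((hi.sqrt hz.ne').smul (hasFDerivAt_fst (𝕜 := ℝ))).add
    ((hasFDerivAt_snd (𝕜 := ℝ)).const_smul (1 / 2 : ℝ))
  refine (congrArg (fun L => L w) h.fderiv).trans ?_
  rw [hs]
  simp
  rw [sub_eq_add_neg]
  congr 3
  ring

/-- The Hamiltonian vector of `k ∘ arcsinExpAux` is mapped to the Hamiltonian vector of `k`. -/
lemma fderiv_arcsinExpAux_euclHamVec {z : E3 × E3} (hz : 0 < 1 - ⟪z.2, z.2⟫ / 4)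
    (h₁ : ⟪z.1, z.1⟫ = 1) (h₀ : ⟪z.1, z.2⟫ = 0) (K : E3 →L[ℝ] ℝ) :
    fderiv ℝ arcsinExpAux z (euclHamVec z (K.comp (fderiv ℝ arcsinExpAux z))) =
      cross (arcsinExpAux z) (gradVec K) := by
  obtain ⟨s, hs⟩ : ∃ s, √(1 - ⟪z.2, z.2⟫ / 4) = s := ⟨_, rfl⟩
  have hs0 : s ≠ 0 := hs ▸ (Real.sqrt_pos.mpr hz).ne'
  obtain ⟨g, hg⟩ : ∃ g, gradVec K = g := ⟨_, rfl⟩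
  have hK : ∀ w, K w = ⟪g, w⟫ := fun w => by rw [← hg, inner_gradVec]
  obtain ⟨t, ht⟩ : ∃ t, ⟪z.1, g⟫ / (4 * s) = t := ⟨_, rfl⟩
  have hgx : gradVec ((K.comp (fderiv ℝ arcsinExpAux z)).comp (.inl ℝ E3 E3)) = s • g := by
    refine gradVec_eq fun w => ?_
    simp only [ContinuousLinearMap.comp_apply, ContinuousLinearMap.inl_apply,
      fderiv_arcsinExpAux hz hs, hK, inner_smul_left]
    simp [inner_smul_right]
  have hgy : gradVec ((K.comp (fderiv ℝ arcsinExpAux z)).comp (.inr ℝ E3 E3)) =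
      (1 / 2 : ℝ) • g - t • z.2 := by
    refine gradVec_eq fun w => ?_
    simp only [ContinuousLinearMap.comp_apply, ContinuousLinearMap.inr_apply,
      fderiv_arcsinExpAux hz hs, hK, inner_smul_left, inner_sub_left, inner_sub_right,
      inner_add_right, inner_smul_right, ← ht, real_inner_comm z.1 g]
    simp
    ring
  have hid := inner_self_smul_cross z.1 z.2 g
  have hc : ⟪z.1, g⟫ = 4 * s * t := by rw [← ht]; field_simp
  obtain ⟨b, hb⟩ : ∃ b, ⟪z.1, cross z.2 g⟫ = b := ⟨_, rfl⟩
  rw [h₁, h₀, one_smul, zero_smul, add_zero, hc, hb] at hid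
  have hyy : cross z.2 z.2 = 0 := by simp [cross]
  have hx : cross z.1 ((1 / 2 : ℝ) • g - t • z.2) =
      (1 / 2 : ℝ) • cross z.1 g - t • cross z.1 z.2 := by
    simp only [← crossL_apply, map_sub, map_smul]
  have hy : cross z.2 ((1 / 2 : ℝ) • g - t • z.2) = (1 / 2 : ℝ) • cross z.2 g := by
    simp only [← crossL_apply, map_sub, map_smul]
    rw [crossL_apply z.2 z.2, hyy, smul_zero, sub_zero]
  have hi : ⟪z.2, (1 / 2 : ℝ) • cross z.2 g + s • cross z.1 g⟫ / (4 * s) = -b / 4 := by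
    rw [inner_add_right, inner_smul_right, inner_smul_right, inner_self_cross_left,
      inner_cross_swap z.2, hb]
    field_simp
    ring
  rw [fderiv_arcsinExpAux hz hs]
  simp only [euclHamVec, LinearMap.coe_mk, AddHom.coe_mk]
  rw [hgx, hgy, hx, hy, cross_smul_right, hi, hg, arcsinExpAux, hs, cross_add_left, cross_smul_left,
    cross_smul_left]
  rw [hid]
  module

/-- The map `arcsinExp` is a Poisson map on the disc bundle of radius `2`. -/
theorem isPoissonMapOn_arcsinExp :
    IsPoissonMapOn tangentBivector sphereBivector arcsinExp {v : TS2 | tnorm v.1 v.2 < 2} where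
  smooth v hv := by
    refine (contMDiffAt_sphere_of_coe ?_).contMDiffWithinAt
    have h := (contDiffAt_arcsinExpAux (n := ∞) (one_sub_inner_pos hv)).contMDiffAt.comp v
      (contMDiff_emb (m := ⊤)).contMDiffAt
    refine h.congr_of_eventuallyEq ?_
    filter_upwards [(isOpen_tnorm_lt 2).mem_nhds hv] with w hw using coe_arcsinExp hw
  bracket_comp f g hf hg v hv := by
    have hz := one_sub_inner_pos hv
    have hP : HasFDerivAt arcsinExpAux _ (emb v) :=
      ((contDiffAt_arcsinExpAux (n := 1) hz).differentiableAt one_ne_zero).hasFDerivAt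
    have hd : ∀ {f : S2 → ℝ}, ContMDiff (𝓡 2) 𝓘(ℝ, ℝ) ∞ f →
        HasFDerivAt (fun z => f (radial (arcsinExpAux z)))
          ((fderiv ℝ (fun x => f (radial x)) (arcsinExp v)).comp
            (fderiv ℝ arcsinExpAux (emb v))) (emb v) := by
      intro f hf
      have h := (differentiableAt_comp_radial hf (arcsinExp v)).hasFDerivAt
      rw [coe_arcsinExp hv] at h ⊢
      exact h.comp (emb v) hP
    have he : ∀ f : S2 → ℝ, f ∘ arcsinExp =ᶠ[𝓝 v] fun w => f (radial (arcsinExpAux (emb w))) := by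
      intro f
      filter_upwards [(isOpen_tnorm_lt 2).mem_nhds hv] with w hw
      rw [← coe_arcsinExp hw, radial_coe, Function.comp_apply]
    rw [tangentBivector_bracket (hd hf).differentiableAt (hd hg).differentiableAt (he f) (he g),
      (hd hf).fderiv, (hd hg).fderiv, sphereBivector_bracket hf hg, ContinuousLinearMap.comp_apply,
      fderiv_arcsinExpAux_euclHamVec hz (inner_emb_fst v) (inner_emb v), coe_arcsinExp hv]

end

/-- The tangent bundle of the round sphere carries exactly one bivector field that is the tangent
Poisson structure of the area-form Poisson structure of the sphere, and for this structure the map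
`(u, p) ↦ Exp_p((1 / |u|) arcsin(|u| / 2) u)` is a Poisson map on `{|u| < 2}`. -/
theorem mainTheorem7 :
    (∃! Λ : BivectorField (𝓡 2).tangent TS2, IsTangentPoisson sphereBivector Λ) ∧
    ∀ Λ : BivectorField (𝓡 2).tangent TS2, IsTangentPoisson sphereBivector Λ →
      IsPoissonMapOn Λ sphereBivector arcsinExp {v : TS2 | tnorm v.1 v.2 < 2} :=
  ⟨⟨tangentBivector, isTangentPoisson_tangentBivector,
    fun _ h => h.eq isTangentPoisson_tangentBivector⟩,
    fun _ h => h.eq isTangentPoisson_tangentBivector ▸ isPoissonMapOn_arcsinExp⟩
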